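/- **Construction.** For a bijection $g$ of a set write $\mathrm{supp}(g)=\{x : g(x)\neq x\}$, and ${}^{g}h=ghg^{-1}$. Let $I_1=(0,1)$ and let $G_1\le \mathrm{Homeo}_c(\mathbb R)$ be Thompson's group $F$ (the piecewise affine homeomorphisms with finitely many breakpoints, all at dyadic rationals, and slopes powers of $2$), acting on $(0,1)$ and fixing its complement. Given an open interval $I_i$ and a group $G_i$ of homeomorphisms supported on $I_i$, choose a compactly supported homeomorphism $t_{i+1}$ of $\mathbb R$ with connected support such that $t_{i+1}(I_i)\cap I_i=\varnothing$. Let $G_i^\omega$ be the set of all homeomorphisms $g$ of $\mathbb R$ supported on $\bigcup_{p\in\mathbb Z} t_{i+1}^p(I_i)$ such that, for every $p\in\mathbb Z$, the restriction of $g$ to $t_{i+1}^p(I_i)$ coincides with that of an element of ${}^{t_{i+1}^p}G_i$ (infinitely many of these restrictions may be non-trivial). Put $G_{i+1}=\langle G_i^\omega, t_{i+1}\rangle$ (which is naturally isomorphic to the unrestricted wreath product of $G_i$ and $\mathbb Z$) and $I_{i+1}=\mathrm{supp}(t_{i+1})$, and let $G=\bigcup_i G_i$ be the directed union. **Definitions.**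 Let $X$ be a set that is the directed union of subsets $(X_i)_{i}$. A group $\Gamma$ of bijections of $X$ is *dissipated* (with respect to $(X_i)_i$) if every $g\in\Gamma$ is supported on some $X_i$ and for every $i$ there is $s\in\Gamma$ such that $s^p(X_i)\cap X_i=\varnothing$ for all $p\ge1$ and, for every $g\in\Gamma$ supported on $X_i$, the map that equals ${}^{s^p}g$ on $s^p(X_i)$ for every $p\ge1$ and the identity elsewhere belongs to $\Gamma$. A group $\Gamma$ *has conjugates in commuting $\mathbb Z$-conjugate* if there are a subgroup $\Lambda\le\Gamma$ and $t\in\Gamma$ such that $[\Lambda,{}^{t^p}\Lambda]=1$ for all $p\ge1$, and every finite subset of $\Gamma$ is contained in a conjugate of $\Lambda$. **Proposition.** The choices of $t_2,t_3,\dots$ in the construction can be made, and for all such choices the group $G$, which acts faithfully on $\bigcup_i I_i$, is dissipated with respect to the intervals $(I_i)_i$, but $G$ does not have conjugates in commuting $\mathbb Z$-conjugate. -/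

import Mathlib

open Set Topology

/-- The support `supp(g) = {x | g x ≠ x}` of a homeomorphism of the line. -/
def homeoSupp (g : ℝ ≃ₜ ℝ) : Set ℝ := {x | g x ≠ x}

/-! ### Thompson's group `F`, acting on `(0, 1)` and fixing the complement -/

/-- `x` is a dyadic rational number. -/
def IsDyadic (x : ℝ) : Prop := ∃ (m k : ℤ), x = m * (2 : ℝ) ^ k

lemma IsDyadic.add {x y : ℝ} (hx : IsDyadic x) (hy : IsDyadic y) : IsDyadic (x + y) := by
  obtain ⟨m, k, rfl⟩ := hx
  obtain ⟨n, l, rfl⟩ := hy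
  have key : ∀ j i : ℤ, j ≤ i → ∃ q : ℤ, (2 : ℝ) ^ i = q * (2 : ℝ) ^ j := by
    intro j i h
    refine ⟨2 ^ (i - j).toNat, ?_⟩
    have h2 : (2 : ℝ) ^ (i - j).toNat = (2 : ℝ) ^ (i - j) := by
      rw [← zpow_natCast, Int.toNat_of_nonneg (by omega)]
    push_cast
    rw [h2, ← zpow_add₀ (by norm_num : (2 : ℝ) ≠ 0)]
    congr 1
    ring
  obtain ⟨q, hq⟩ := key (min k l) k (min_le_left _ _)
  obtain ⟨r, hr⟩ := key (min k l) l (min_le_right _ _)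
  refine ⟨m * q + n * r, min k l, ?_⟩
  rw [hq, hr]
  push_cast
  ring

lemma IsDyadic.neg {x : ℝ} (hx : IsDyadic x) : IsDyadic (-x) := by
  obtain ⟨m, k, rfl⟩ := hx
  exact ⟨-m, k, by push_cast; ring⟩

lemma IsDyadic.zpow_mul {x : ℝ} (hx : IsDyadic x) (j : ℤ) : IsDyadic ((2 : ℝ) ^ j * x) := by
  obtain ⟨m, k, rfl⟩ := hx
  refine ⟨m, j + k, ?_⟩
  rw [zpow_add₀ (by norm_num : (2 : ℝ) ≠ 0)]
  ring

lemma IsDyadic.zero : IsDyadic 0 := ⟨0, 0, by simp⟩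

/-- Thompson's group `F`: the homeomorphisms of the line that fix every point outside `(0, 1)`
and are piecewise affine, with finitely many breakpoints, all of them at dyadic points with dyadic
images, and of the form `y ↦ 2 ^ k * y + c` with `k` an integer and `c` dyadic near every other
point. -/
def thompsonF : Subgroup (ℝ ≃ₜ ℝ) where
  carrier := {g | (∀ x, x ∉ Ioo (0 : ℝ) 1 → g x = x) ∧
    ∃ B : Set ℝ, B.Finite ∧ (∀ b ∈ B, IsDyadic b ∧ IsDyadic (g b)) ∧
      ∀ x, x ∉ B → ∃ (k : ℤ) (c : ℝ), IsDyadic c ∧ ∀ᶠ y in 𝓝 x, g y = (2 : ℝ) ^ k * y + c}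
  one_mem' := by
    refine ⟨fun x _ => rfl, ∅, finite_empty, by simp, fun x _ => ⟨0, 0, IsDyadic.zero, ?_⟩⟩
    exact Filter.Eventually.of_forall fun y => by simp
  mul_mem' := by
    rintro f g ⟨hf, A, hA, hAd, hAl⟩ ⟨hg, B, hB, hBd, hBl⟩
    have val : ∀ {h : ℝ ≃ₜ ℝ} {C : Set ℝ}, (∀ b ∈ C, IsDyadic b ∧ IsDyadic (h b)) →
        (∀ x, x ∉ C → ∃ (k : ℤ) (c : ℝ), IsDyadic c ∧ ∀ᶠ y in 𝓝 x, h y = (2 : ℝ) ^ k * y + c) →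
        ∀ x, IsDyadic x ↔ IsDyadic (h x) := by
      intro h C h1 h2 x
      by_cases hx : x ∈ C
      · exact ⟨fun _ => (h1 x hx).2, fun _ => (h1 x hx).1⟩
      · obtain ⟨k, c, hc, he⟩ := h2 x hx
        have e := he.self_of_nhds
        rw [e]
        refine ⟨fun hd => (hd.zpow_mul k).add hc, fun hd => ?_⟩
        have := (hd.add hc.neg).zpow_mul (-k)
        rwa [add_neg_cancel_right, ← mul_assoc, ← zpow_add₀ (by norm_num : (2 : ℝ) ≠ 0),
          neg_add_cancel, zpow_zero, one_mul] at this
    have vf := val hAd hAl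
    have vg := val hBd hBl
    refine ⟨fun x hx => ?_, B ∪ g ⁻¹' A, hB.union (hA.preimage g.injective.injOn), ?_, ?_⟩
    · change f (g x) = x
      rw [hg x hx, hf x hx]
    · rintro b (hb | hb)
      · exact ⟨(hBd b hb).1, (vf _).1 (hBd b hb).2⟩
      · exact ⟨(vg b).2 (hAd _ hb).1, (hAd _ hb).2⟩
    · intro x hx
      simp only [mem_union, mem_preimage, not_or] at hx
      obtain ⟨k, c, hc, he⟩ := hBl x hx.1
      obtain ⟨l, d, hd, hfe⟩ := hAl (g x) hx.2
      refine ⟨l + k, (2 : ℝ) ^ l * c + d, (hc.zpow_mul l).add hd, ?_⟩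
      filter_upwards [he, g.continuous.continuousAt.eventually hfe] with y h1 h2
      change f (g y) = _
      rw [h2, h1, zpow_add₀ (by norm_num : (2 : ℝ) ≠ 0)]
      ring
  inv_mem' := by
    rintro g ⟨hg, B, hB, hBd, hBl⟩
    have hinv : ∀ x, g⁻¹ x = g.symm x := fun _ => rfl
    refine ⟨fun x hx => ?_, g '' B, hB.image g, ?_, ?_⟩
    · rw [hinv, Homeomorph.symm_apply_eq, hg x hx]
    · rintro _ ⟨b, hb, rfl⟩
      rw [hinv, g.symm_apply_apply]
      exact ⟨(hBd b hb).2, (hBd b hb).1⟩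
    · intro x hx
      have hx' : g.symm x ∉ B := fun h => hx ⟨_, h, g.apply_symm_apply x⟩
      obtain ⟨k, c, hc, he⟩ := hBl _ hx'
      refine ⟨-k, (2 : ℝ) ^ (-k) * (-c), hc.neg.zpow_mul (-k), ?_⟩
      filter_upwards [g.symm.continuous.continuousAt.eventually he] with y hy
      rw [g.apply_symm_apply] at hy
      rw [hinv]
      have h2 : (2 : ℝ) ^ (-k) * (2 : ℝ) ^ k = 1 := by
        rw [← zpow_add₀ (by norm_num : (2 : ℝ) ≠ 0), neg_add_cancel, zpow_zero]
      calc g.symm y = ((2 : ℝ) ^ (-k) * (2 : ℝ) ^ k) * g.symm y := by rw [h2, one_mul]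
        _ = (2 : ℝ) ^ (-k) * ((2 : ℝ) ^ k * g.symm y + c) + (2 : ℝ) ^ (-k) * (-c) := by ring
        _ = _ := by rw [← hy]

/-! ### The iterated construction

The stages are numbered from `0`: stage `n` consists of the interval `stageInterval t n` and the
group `stageGroup t n`, and the homeomorphism `t n` leads from stage `n` to stage `n + 1`. -/

/-- The intervals: first `(0, 1)`, then the supports of the chosen homeomorphisms. -/
def stageInterval (t : ℕ → ℝ ≃ₜ ℝ) : ℕ → Set ℝ
  | 0 => Ioo 0 1
  | n + 1 => homeoSupp (t n)

/-- The homeomorphisms `g` supported on the union of the sets `s ^ p (I)`, `p ∈ ℤ`, whose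
restriction to each `s ^ p (I)` coincides with that of an element of `s ^ p H s ^ (-p)`; there is
no finiteness condition on the set of `p` at which `g` acts non-trivially. -/
def omegaPower (H : Subgroup (ℝ ≃ₜ ℝ)) (I : Set ℝ) (s : ℝ ≃ₜ ℝ) : Set (ℝ ≃ₜ ℝ) :=
  {g | homeoSupp g ⊆ ⋃ p : ℤ, (s ^ p) '' I ∧
    ∀ p : ℤ, ∃ h ∈ H, ∀ x ∈ (s ^ p) '' I, g x = (s ^ p * h * (s ^ p)⁻¹) x}

/-- The groups: first Thompson's group `F`, then the group generated by the previous
`omegaPower` and the chosen homeomorphism. -/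
def stageGroup (t : ℕ → ℝ ≃ₜ ℝ) : ℕ → Subgroup (ℝ ≃ₜ ℝ)
  | 0 => thompsonF
  | n + 1 => Subgroup.closure (omegaPower (stageGroup t n) (stageInterval t n) (t n) ∪ {t n})

/-- The conditions on the choices: each `t n` is compactly supported, has connected support, and
moves the interval of stage `n` off itself. -/
def IsAdmissible (t : ℕ → ℝ ≃ₜ ℝ) : Prop :=
  ∀ n, Bornology.IsBounded (homeoSupp (t n)) ∧ IsConnected (homeoSupp (t n)) ∧
    Disjoint (t n '' stageInterval t n) (stageInterval t n)

/-- The directed union `G` of the groups of all stages. -/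
def limitGroup (t : ℕ → ℝ ≃ₜ ℝ) : Subgroup (ℝ ≃ₜ ℝ) := ⨆ n, stageGroup t n

/-! ### Dissipated groups -/

/-- `X` is the directed union of the sets `B i`, and every element of the group `Γ` of bijections
of `X` is supported on some `B i`. -/
def IsBoundedlySupported {X ι : Type*} (Γ : Subgroup (Equiv.Perm X)) (B : ι → Set X) : Prop :=
  Directed (· ⊆ ·) B ∧ ⋃ i, B i = univ ∧ ∀ g ∈ Γ, ∃ i, {x | g x ≠ x} ⊆ B i

/-- `s` is a dissipator for `Γ` and `A`: the positive powers of `s` move `A` off itself, and for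
every `g ∈ Γ` supported on `A`, the map that equals `s ^ p g s ^ (-p)` on `s ^ p (A)` for every
`p ≥ 1` and the identity elsewhere belongs to `Γ`. -/
def IsDissipator {X : Type*} (Γ : Subgroup (Equiv.Perm X)) (A : Set X) (s : Equiv.Perm X) : Prop :=
  s ∈ Γ ∧ (∀ p : ℕ, 1 ≤ p → Disjoint ((s ^ p) '' A) A) ∧
    ∀ g ∈ Γ, {x | g x ≠ x} ⊆ A → ∃ f ∈ Γ,
      (∀ p : ℕ, 1 ≤ p → ∀ x ∈ (s ^ p) '' A, f x = (s ^ p * g * (s ^ p)⁻¹) x) ∧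
      ∀ x, (∀ p : ℕ, 1 ≤ p → x ∉ (s ^ p) '' A) → f x = x

/-- The group `Γ` of bijections of `X` is dissipated with respect to the bounded sets `B i`. -/
def IsDissipated {X ι : Type*} (Γ : Subgroup (Equiv.Perm X)) (B : ι → Set X) : Prop :=
  IsBoundedlySupported Γ B ∧ ∀ i, ∃ s, IsDissipator Γ (B i) s

/-! ### Conjugates in commuting `ℤ`-conjugate -/

/-- The group `Γ` has conjugates in commuting `ℤ`-conjugate. -/
def HasConjugatesInCommutingZConjugate (Γ : Type*) [Group Γ] : Prop :=
  ∃ (Λ : Subgroup Γ) (s : Γ),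
    (∀ p : ℕ, 1 ≤ p → ⁅Λ, Λ.map (MulAut.conj (s ^ p)).toMonoidHom⁆ = ⊥) ∧
    ∀ S : Set Γ, S.Finite → ∃ r : Γ, S ⊆ (Λ.map (MulAut.conj r).toMonoidHom : Subgroup Γ)

/-! ### Supports and monotonicity of homeomorphisms of the line -/

/-! Write I_n, G_n for the stages. Everything rests on a shift: an element of G_{n+1} permutes the
translates t_n^q(I_n) by q ↦ q + p with p independent of q, acting through elements of G_n
(`exists_shift_of_mem_stageGroup_succ`). By induction on stages, each I_m is a block for G, and an
element preserving I_m acts on it as an element of G_m (`disjoint_or_eqOn_of_mem_limitGroup`).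

Dissipation: an element of G supported on I_n thus lies in G_n. Since G_n^ω carries no finiteness
condition, placing its conjugates on the translates with p ≥ 1 gives an element of G_{n+1}, so t_n
is a dissipator.

No commuting conjugates: suppose Λ and s are as in the definition, with s ∈ G_n. Some conjugate
rΛr⁻¹ contains t_n and t_{n+1}, so t_n commutes with u t_{n+1} u⁻¹, where u = r s r⁻¹. By the block
property either u ∈ G_{n+2}, or u commutes with G_{n+2} and may be replaced by 1
(`conj_mem_or_commute`). Shifts take values in the abelian group ℤ, so u t_{n+1} u⁻¹ still shifts by
one and moves I_{n+1} off itself. It cannot commute with t_n ≠ 1, which is supported on I_{n+1}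
(`not_commute_conj_of_mem_stageGroup`). -/

lemma mem_of_homeoSupp_subset {g : ℝ ≃ₜ ℝ} {A : Set ℝ} (hg : homeoSupp g ⊆ A) {x : ℝ}
    (hx : x ∈ A) : g x ∈ A := by
  by_cases h : g x = x
  · rwa [h]
  · exact hg fun h' => h (g.injective h')

lemma apply_eq_of_homeoSupp_subset {g : ℝ ≃ₜ ℝ} {A : Set ℝ} (hg : homeoSupp g ⊆ A) {x : ℝ}
    (hx : x ∉ A) : g x = x := by
  by_contra h
  exact hx (hg h)

/-- The homeomorphisms supported on a given set form a subgroup. -/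
def homeoSuppSubgroup (A : Set ℝ) : Subgroup (ℝ ≃ₜ ℝ) where
  carrier := {g | homeoSupp g ⊆ A}
  one_mem' := fun _ hx => (hx rfl).elim
  mul_mem' := by
    intro f g hf hg x hx
    by_contra h
    apply hx
    change f (g x) = x
    rw [apply_eq_of_homeoSupp_subset hg h, apply_eq_of_homeoSupp_subset hf h]
  inv_mem' := by
    intro g hg x hx
    by_contra h
    apply hx
    change g.symm x = x
    rw [Homeomorph.symm_apply_eq, apply_eq_of_homeoSupp_subset hg h]

lemma mem_homeoSuppSubgroup {A : Set ℝ} {g : ℝ ≃ₜ ℝ} :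
    g ∈ homeoSuppSubgroup A ↔ homeoSupp g ⊆ A := Iff.rfl

lemma homeo_eq_of_eqOn {g h : ℝ ≃ₜ ℝ} {A : Set ℝ} (hg : homeoSupp g ⊆ A)
    (hh : homeoSupp h ⊆ A) (e : ∀ x ∈ A, g x = h x) : g = h := by
  ext x
  by_cases hx : x ∈ A
  · exact e x hx
  · rw [apply_eq_of_homeoSupp_subset hg hx, apply_eq_of_homeoSupp_subset hh hx]

lemma homeo_mul_apply (f g : ℝ ≃ₜ ℝ) (x : ℝ) : (f * g) x = f (g x) := rfl

lemma homeo_one_apply (x : ℝ) : (1 : ℝ ≃ₜ ℝ) x = x := rfl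

lemma homeo_inv_apply_self (f : ℝ ≃ₜ ℝ) (x : ℝ) : f⁻¹ (f x) = x := f.symm_apply_apply x

lemma homeo_apply_inv_self (f : ℝ ≃ₜ ℝ) (x : ℝ) : f (f⁻¹ x) = x := f.apply_symm_apply x

lemma homeo_zpow_add_apply (f : ℝ ≃ₜ ℝ) (p q : ℤ) (x : ℝ) :
    (f ^ (p + q)) x = (f ^ p) ((f ^ q) x) := by
  rw [zpow_add, homeo_mul_apply]

lemma strictMono_of_isBounded_homeoSupp {g : ℝ ≃ₜ ℝ}
    (hg : Bornology.IsBounded (homeoSupp g)) : StrictMono g := by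
  rcases g.continuous.strictMono_of_inj g.injective with h | h
  · exact h
  · obtain ⟨r, hr⟩ := hg.subset_ball 0
    have fix : ∀ x, r ≤ x → g x = x := fun x hx =>
      apply_eq_of_homeoSupp_subset hr fun hb => by
        rw [Metric.mem_ball, dist_zero_right, Real.norm_eq_abs, abs_lt] at hb
        linarith
    have := h (lt_add_one r)
    rw [fix r le_rfl, fix (r + 1) (by linarith)] at this
    linarith

/-- By monotonicity an orbit drifts in one direction, so `s x` lies between `x` and `(s ^ p) x`;
convexity of `I` would then put `s x` in `I`. -/
lemma disjoint_pow_image {s : ℝ ≃ₜ ℝ} {I : Set ℝ} (hs : StrictMono s) (hI : I.OrdConnected)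
    (hd : Disjoint (s '' I) I) (p : ℕ) (hp : 1 ≤ p) {x : ℝ} (hx : x ∈ I) : (s ^ p) x ∉ I := by
  intro hpx
  have hn : s x ∉ I := fun h => disjoint_left.1 hd (mem_image_of_mem s hx) h
  apply hn
  have iter : ∀ k : ℕ, (s ^ (k + 1)) x = s ((s ^ k) x) := fun k => by
    rw [pow_succ', homeo_mul_apply]
  obtain ⟨k, rfl⟩ := Nat.exists_eq_add_of_le' hp
  rcases lt_trichotomy x (s x) with h | h | h
  · have up : ∀ k : ℕ, s x ≤ (s ^ (k + 1)) x := by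
      intro k
      induction k with
      | zero => rw [zero_add, pow_one]
      | succ k ih =>
        rw [iter (k + 1)]
        exact hs.monotone (h.le.trans ih)
    exact hI.out hx hpx ⟨h.le, up k⟩
  · rwa [← h]
  · have down : ∀ k : ℕ, (s ^ (k + 1)) x ≤ s x := by
      intro k
      induction k with
      | zero => rw [zero_add, pow_one]
      | succ k ih =>
        rw [iter (k + 1)]
        exact hs.monotone (ih.trans h.le)
    exact hI.out hpx hx ⟨down k, h.le⟩

lemma disjoint_zpow_image {s : ℝ ≃ₜ ℝ} {I : Set ℝ} (hs : StrictMono s) (hI : I.OrdConnected)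
    (hd : Disjoint (s '' I) I) {p : ℤ} (hp : p ≠ 0) {x : ℝ} (hx : x ∈ I) : (s ^ p) x ∉ I := by
  intro hpx
  rcases Int.eq_nat_or_neg p with ⟨k, rfl | rfl⟩
  · rw [zpow_natCast] at hpx
    exact disjoint_pow_image hs hI hd k (by omega) hx hpx
  · refine disjoint_pow_image hs hI hd k (by omega) hpx ?_
    rwa [← zpow_natCast, ← homeo_zpow_add_apply, add_neg_cancel, zpow_zero]

lemma pairwise_disjoint_zpow_image {s : ℝ ≃ₜ ℝ} {I : Set ℝ} (hs : StrictMono s)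
    (hI : I.OrdConnected) (hd : Disjoint (s '' I) I) :
    Pairwise fun p q : ℤ => Disjoint ((s ^ p) '' I) ((s ^ q) '' I) := by
  intro p q hpq
  rw [disjoint_left]
  rintro _ ⟨x, hx, rfl⟩ ⟨y, hy, e⟩
  refine disjoint_zpow_image hs hI hd (p := -p + q) (by omega) hy ?_
  rwa [homeo_zpow_add_apply, e, ← homeo_zpow_add_apply, neg_add_cancel, zpow_zero]

lemma strictMono_homeo_inv {g : ℝ ≃ₜ ℝ} (hg : StrictMono g) : StrictMono (g⁻¹ : ℝ ≃ₜ ℝ) :=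
  fun x y h => by
    rw [← hg.lt_iff_lt, homeo_apply_inv_self, homeo_apply_inv_self]
    exact h

lemma strictMono_homeo_zpow {g : ℝ ≃ₜ ℝ} (hg : StrictMono g) (p : ℤ) :
    StrictMono (g ^ p : ℝ ≃ₜ ℝ) := by
  have nat : ∀ {f : ℝ ≃ₜ ℝ}, StrictMono f → ∀ k : ℕ, StrictMono (f ^ k : ℝ ≃ₜ ℝ) := by
    intro f hf k
    induction k with
    | zero => exact strictMono_id
    | succ k ih =>
      rw [pow_succ]
      exact ih.comp hf
  rcases Int.eq_nat_or_neg p with ⟨k, rfl | rfl⟩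
  · rw [zpow_natCast]
    exact nat hg k
  · rw [zpow_neg, zpow_natCast, ← inv_pow]
    exact nat (strictMono_homeo_inv hg) k

lemma ordConnected_image_homeo {g : ℝ ≃ₜ ℝ} (hg : StrictMono g) {I : Set ℝ}
    (hI : I.OrdConnected) : (g '' I).OrdConnected := by
  refine ⟨?_⟩
  rintro _ ⟨x, hx, rfl⟩ _ ⟨y, hy, rfl⟩ z ⟨h1, h2⟩
  obtain ⟨w, rfl⟩ := g.surjective z
  exact ⟨w, hI.out hx hy ⟨hg.le_iff_le.1 h1, hg.le_iff_le.1 h2⟩, rfl⟩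

/-! ### Gluing homeomorphisms with disjoint supports -/

open Classical in
/-- The map that equals `φ p` on `J p` for every `p` and the identity elsewhere. -/
noncomputable def glueMap {ι : Type*} (J : ι → Set ℝ) (φ : ι → ℝ ≃ₜ ℝ) (x : ℝ) : ℝ :=
  if h : ∃ p, x ∈ J p then φ h.choose x else x

section Glue

variable {ι : Type*} {J : ι → Set ℝ} {φ : ι → ℝ ≃ₜ ℝ}

lemma glueMap_of_mem (hd : Pairwise fun p q => Disjoint (J p) (J q)) {p : ι} {x : ℝ}
    (hx : x ∈ J p) : glueMap J φ x = φ p x := by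
  have h : ∃ p, x ∈ J p := ⟨p, hx⟩
  have e : h.choose = p := by
    by_contra hne
    exact disjoint_left.1 (hd hne) h.choose_spec hx
  rw [glueMap, dif_pos h, e]

lemma glueMap_of_notMem {x : ℝ} (hx : ∀ p, x ∉ J p) : glueMap J φ x = x :=
  dif_neg fun ⟨p, hp⟩ => hx p hp

lemma strictMono_glueMap (hJ : ∀ p, (J p).OrdConnected)
    (hd : Pairwise fun p q => Disjoint (J p) (J q)) (hφ : ∀ p, StrictMono (φ p))
    (hs : ∀ p, homeoSupp (φ p) ⊆ J p) : StrictMono (glueMap J φ) := by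
  -- A point `y` moves only within its own convex piece, so it cannot cross a point `z` outside that
  -- piece.
  have right : ∀ {z y : ℝ}, z < y → (∀ p, z ∈ J p → y ∉ J p) → z < glueMap J φ y := by
    intro z y hzy hne
    by_cases hy : ∃ q, y ∈ J q
    · obtain ⟨q, hq⟩ := hy
      rw [glueMap_of_mem hd hq]
      by_contra! hle
      exact hne q ((hJ q).out (mem_of_homeoSupp_subset (hs q) hq) hq ⟨hle, hzy.le⟩) hq
    · rwa [glueMap_of_notMem fun p hp => hy ⟨p, hp⟩]
  intro x y hxy
  by_cases hx : ∃ p, x ∈ J p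
  · obtain ⟨p, hp⟩ := hx
    have hp' := mem_of_homeoSupp_subset (hs p) hp
    by_cases hy : y ∈ J p
    · rw [glueMap_of_mem hd hp, glueMap_of_mem hd hy]
      exact hφ p hxy
    · rw [glueMap_of_mem hd hp]
      refine right ?_ fun q hq hyq => ?_
      · by_contra! hle
        exact hy ((hJ p).out hp hp' ⟨hxy.le, hle⟩)
      · have : q = p := by
          by_contra hne
          exact disjoint_left.1 (hd hne) hq hp'
        exact hy (this ▸ hyq)
  · rw [glueMap_of_notMem fun p hp => hx ⟨p, hp⟩]
    exact right hxy fun p hp _ => hx ⟨p, hp⟩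

lemma surjective_glueMap (hd : Pairwise fun p q => Disjoint (J p) (J q))
    (hs : ∀ p, homeoSupp (φ p) ⊆ J p) : Function.Surjective (glueMap J φ) := by
  intro y
  by_cases hy : ∃ p, y ∈ J p
  · obtain ⟨p, hp⟩ := hy
    have hs' : homeoSupp (φ p)⁻¹ ⊆ J p :=
      mem_homeoSuppSubgroup.1 (inv_mem (mem_homeoSuppSubgroup.2 (hs p)))
    exact ⟨(φ p)⁻¹ y, by
      rw [glueMap_of_mem hd (mem_of_homeoSupp_subset hs' hp), homeo_apply_inv_self]⟩
  · exact ⟨y, glueMap_of_notMem fun p hp => hy ⟨p, hp⟩⟩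

/-- An increasing surjection of the line is automatically a homeomorphism, so continuity where the
pieces accumulate needs no separate argument. -/
lemma exists_homeo_glue (hJ : ∀ p, (J p).OrdConnected)
    (hd : Pairwise fun p q => Disjoint (J p) (J q)) (hφ : ∀ p, StrictMono (φ p))
    (hs : ∀ p, homeoSupp (φ p) ⊆ J p) :
    ∃ f : ℝ ≃ₜ ℝ, (∀ p, ∀ x ∈ J p, f x = φ p x) ∧ ∀ x, (∀ p, x ∉ J p) → f x = x :=
  ⟨((strictMono_glueMap hJ hd hφ hs).orderIsoOfSurjective _
      (surjective_glueMap hd hs)).toHomeomorph,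
    fun _ _ hx => glueMap_of_mem hd hx, fun _ hx => glueMap_of_notMem hx⟩

end Glue

/-! ### The stages of the construction -/

section Stages

variable {t : ℕ → ℝ ≃ₜ ℝ}

lemma stageInterval_nonempty (ht : IsAdmissible t) : ∀ n, (stageInterval t n).Nonempty
  | 0 => ⟨1 / 2, by norm_num [stageInterval]⟩
  | n + 1 => (ht n).2.1.nonempty

lemma stageInterval_ordConnected (ht : IsAdmissible t) : ∀ n, (stageInterval t n).OrdConnected
  | 0 => ordConnected_Ioo
  | n + 1 => (ht n).2.1.isPreconnected.ordConnected

lemma stageInterval_isBounded (ht : IsAdmissible t) :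
    ∀ n, Bornology.IsBounded (stageInterval t n)
  | 0 => Metric.isBounded_Ioo 0 1
  | n + 1 => (ht n).1

lemma strictMono_of_isAdmissible (ht : IsAdmissible t) (n : ℕ) : StrictMono (t n) :=
  strictMono_of_isBounded_homeoSupp (ht n).1

lemma stageInterval_subset_succ (ht : IsAdmissible t) (n : ℕ) :
    stageInterval t n ⊆ stageInterval t (n + 1) := fun x hx e => by
  have := disjoint_left.1 (ht n).2.2 (mem_image_of_mem _ hx)
  rw [e] at this
  exact this hx

lemma stageInterval_monotone (ht : IsAdmissible t) : Monotone (stageInterval t) :=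
  monotone_nat_of_le_succ (stageInterval_subset_succ ht)

lemma zpow_apply_notMem_stageInterval (ht : IsAdmissible t) {n : ℕ} {p : ℤ} (hp : p ≠ 0)
    {x : ℝ} (hx : x ∈ stageInterval t n) : (t n ^ p) x ∉ stageInterval t n :=
  disjoint_zpow_image (strictMono_of_isAdmissible ht n) (stageInterval_ordConnected ht n)
    (ht n).2.2 hp hx

lemma homeoSupp_subset_of_mem_stageGroup (ht : IsAdmissible t) :
    ∀ {n : ℕ} {g : ℝ ≃ₜ ℝ}, g ∈ stageGroup t n → homeoSupp g ⊆ stageInterval t n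
  | 0, g, hg => fun x hx => by
    by_contra h
    exact hx (hg.1 x h)
  | n + 1, g, hg => by
    rw [← mem_homeoSuppSubgroup]
    have hle : stageGroup t (n + 1) ≤ homeoSuppSubgroup (stageInterval t (n + 1)) := by
      rw [stageGroup, Subgroup.closure_le]
      have ht' : t n ∈ homeoSuppSubgroup (stageInterval t (n + 1)) := Subset.rfl
      rintro g (hg | rfl)
      · refine hg.1.trans (iUnion_subset fun p => ?_)
        rintro _ ⟨x, hx, rfl⟩
        exact mem_of_homeoSupp_subset (mem_homeoSuppSubgroup.1 (zpow_mem ht' p))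
          (stageInterval_subset_succ ht n hx)
      · exact ht'
    exact hle hg

lemma mem_stageGroup_succ (t : ℕ → ℝ ≃ₜ ℝ) (n : ℕ) : t n ∈ stageGroup t (n + 1) :=
  Subgroup.subset_closure (Or.inr rfl)

/-- An element of stage `n` is the family with itself at `p = 0` and the identity at every other
`p`. -/
lemma stageGroup_le_succ (ht : IsAdmissible t) (n : ℕ) :
    stageGroup t n ≤ stageGroup t (n + 1) := by
  intro g hg
  have hs := homeoSupp_subset_of_mem_stageGroup ht hg
  refine Subgroup.subset_closure (Or.inl ⟨fun x hx => mem_iUnion.2 ⟨0, x, hs hx, rfl⟩, fun p => ?_⟩)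
  by_cases hp : p = 0
  · subst hp
    exact ⟨g, hg, fun x _ => by simp⟩
  · refine ⟨1, one_mem _, ?_⟩
    rintro _ ⟨x, hx, rfl⟩
    rw [mul_one, mul_inv_cancel, homeo_one_apply]
    exact apply_eq_of_homeoSupp_subset hs (zpow_apply_notMem_stageInterval ht hp hx)

lemma stageGroup_monotone (ht : IsAdmissible t) : Monotone (stageGroup t) :=
  monotone_nat_of_le_succ (stageGroup_le_succ ht)

lemma mem_limitGroup_iff (ht : IsAdmissible t) {g : ℝ ≃ₜ ℝ} :
    g ∈ limitGroup t ↔ ∃ n, g ∈ stageGroup t n :=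
  Subgroup.mem_iSup_of_directed (stageGroup_monotone ht).directed_le

/-- An element of stage `n + 1` permutes the translates `(t n) ^ q (I_n)` by a shift, and acts
between them by elements of stage `n`. -/
lemma exists_shift_of_mem_stageGroup_succ (ht : IsAdmissible t) {n : ℕ} {g : ℝ ≃ₜ ℝ}
    (hg : g ∈ stageGroup t (n + 1)) :
    ∃ p : ℤ, ∀ q : ℤ, ∃ h ∈ stageGroup t n, ∀ x ∈ stageInterval t n,
      g ((t n ^ q) x) = (t n ^ (q + p)) (h x) := by
  rw [stageGroup] at hg
  induction hg using Subgroup.closure_induction with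
  | mem g hg =>
    rcases hg with hg | rfl
    · refine ⟨0, fun q => ?_⟩
      obtain ⟨h, hh, e⟩ := hg.2 q
      refine ⟨h, hh, fun x hx => ?_⟩
      rw [e _ (mem_image_of_mem _ hx), homeo_mul_apply, homeo_mul_apply, homeo_inv_apply_self,
        add_zero]
    · refine ⟨1, fun q => ⟨1, one_mem _, fun x _ => ?_⟩⟩
      rw [add_comm, homeo_zpow_add_apply, zpow_one, homeo_one_apply]
  | one => exact ⟨0, fun q => ⟨1, one_mem _, fun x _ => by rw [add_zero]; rfl⟩⟩
  | mul a b _ _ iha ihb =>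
    obtain ⟨p, ha⟩ := iha
    obtain ⟨r, hb⟩ := ihb
    refine ⟨r + p, fun q => ?_⟩
    obtain ⟨h, hh, e⟩ := hb q
    -- `b` has already carried the translate of index `q` to that of index `q + r`.
    obtain ⟨k, hk, e'⟩ := ha (q + r)
    refine ⟨k * h, mul_mem hk hh, fun x hx => ?_⟩
    rw [homeo_mul_apply, e x hx,
      e' _ (mem_of_homeoSupp_subset (homeoSupp_subset_of_mem_stageGroup ht hh) hx), add_assoc,
      homeo_mul_apply]
  | inv a _ iha =>
    obtain ⟨p, ha⟩ := iha
    refine ⟨-p, fun q => ?_⟩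
    obtain ⟨h, hh, e⟩ := ha (q + -p)
    refine ⟨h⁻¹, inv_mem hh, fun x hx => ?_⟩
    have := e (h⁻¹ x)
      (mem_of_homeoSupp_subset (homeoSupp_subset_of_mem_stageGroup ht (inv_mem hh)) hx)
    rw [neg_add_cancel_right, homeo_apply_inv_self] at this
    rw [← this, homeo_inv_apply_self]

/-- The intervals `I_m` are blocks of `G`: an element of `G` either moves `I_m` off itself or acts
on `I_m` as an element of stage `m`. -/
lemma disjoint_or_eqOn_of_mem_limitGroup (ht : IsAdmissible t) {g : ℝ ≃ₜ ℝ}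
    (hg : g ∈ limitGroup t) (m : ℕ) :
    (∀ x ∈ stageInterval t m, g x ∉ stageInterval t m) ∨
      ∃ h ∈ stageGroup t m, ∀ x ∈ stageInterval t m, g x = h x := by
  obtain ⟨k, hk⟩ := (mem_limitGroup_iff ht).1 hg
  have hk' := stageGroup_monotone ht (le_max_left k m) hk
  generalize hl : max k m = l at hk'
  have hml : m ≤ l := hl ▸ le_max_right k m
  clear hl hk hg
  induction l, hml using Nat.le_induction generalizing g with
  | base => exact Or.inr ⟨g, hk', fun _ _ => rfl⟩
  | succ l hml ih =>
    obtain ⟨p, hp⟩ := exists_shift_of_mem_stageGroup_succ ht hk'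
    -- Only the translate of index 0 matters, since `I_m ⊆ I_l`. A nonzero shift moves all of `I_l`
    -- off itself; a zero shift reduces the claim to `h`, one stage lower.
    obtain ⟨h, hh, e⟩ := hp 0
    simp only [zpow_zero, homeo_one_apply, zero_add] at e
    have hsub := stageInterval_monotone ht hml
    by_cases hp0 : p = 0
    · simp only [hp0, zpow_zero, homeo_one_apply] at e
      rcases ih hh with h1 | ⟨k, hk, e'⟩
      · left
        intro x hx
        rw [e x (hsub hx)]
        exact h1 x hx
      · right
        exact ⟨k, hk, fun x hx => by rw [e x (hsub hx), e' x hx]⟩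
    · left
      intro x hx hgx
      have hhx := mem_of_homeoSupp_subset (homeoSupp_subset_of_mem_stageGroup ht hh) (hsub hx)
      refine zpow_apply_notMem_stageInterval ht hp0 hhx ?_
      rw [← e x (hsub hx)]
      exact hsub hgx

/-- A map supported on the nonempty set `I_m` preserves it, which excludes the first alternative of
the block property. -/
lemma mem_stageGroup_of_homeoSupp_subset (ht : IsAdmissible t) {g : ℝ ≃ₜ ℝ}
    (hg : g ∈ limitGroup t) {m : ℕ} (hs : homeoSupp g ⊆ stageInterval t m) :
    g ∈ stageGroup t m := by
  rcases disjoint_or_eqOn_of_mem_limitGroup ht hg m with h | ⟨h, hh, e⟩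
  · obtain ⟨x, hx⟩ := stageInterval_nonempty ht m
    exact (h x hx (mem_of_homeoSupp_subset hs hx)).elim
  · rwa [homeo_eq_of_eqOn hs (homeoSupp_subset_of_mem_stageGroup ht hh) e]

/-- Every family of elements of stage `n` is realized by an element of stage `n + 1`. -/
lemma exists_mem_stageGroup_succ_of_family (ht : IsAdmissible t) {n : ℕ} {h : ℤ → ℝ ≃ₜ ℝ}
    (hh : ∀ p, h p ∈ stageGroup t n) :
    ∃ f ∈ stageGroup t (n + 1),
      (∀ p : ℤ, ∀ x ∈ (t n ^ p) '' stageInterval t n, f x = (t n ^ p * h p * (t n ^ p)⁻¹) x) ∧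
      ∀ x, (∀ p : ℤ, x ∉ (t n ^ p) '' stageInterval t n) → f x = x := by
  have hmono := strictMono_of_isAdmissible ht n
  have hord := stageInterval_ordConnected ht n
  obtain ⟨f, hf, hf'⟩ := exists_homeo_glue (J := fun p : ℤ => (t n ^ p) '' stageInterval t n)
    (φ := fun p : ℤ => t n ^ p * h p * (t n ^ p)⁻¹)
    (fun p => ordConnected_image_homeo (strictMono_homeo_zpow hmono p) hord)
    (pairwise_disjoint_zpow_image hmono hord (ht n).2.2)
    (fun p => by
      have h1 : StrictMono (h p) := strictMono_of_isBounded_homeoSupp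
        ((stageInterval_isBounded ht n).subset (homeoSupp_subset_of_mem_stageGroup ht (hh p)))
      have h2 := strictMono_homeo_zpow hmono p
      exact (h2.comp h1).comp (strictMono_homeo_inv h2))
    (fun p x hx => by
      refine ⟨(t n ^ p)⁻¹ x, ?_, homeo_apply_inv_self _ _⟩
      by_contra hne
      apply hx
      rw [homeo_mul_apply, homeo_mul_apply,
        apply_eq_of_homeoSupp_subset (homeoSupp_subset_of_mem_stageGroup ht (hh p)) hne,
        homeo_apply_inv_self])
  refine ⟨f, Subgroup.subset_closure (Or.inl ⟨fun x hx => ?_, fun p => ⟨h p, hh p, hf p⟩⟩), hf, hf'⟩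
  by_contra hne
  exact hx (hf' x fun p hp => hne (mem_iUnion.2 ⟨p, hp⟩))

/-! ### The action on the union of the intervals is dissipated -/

lemma homeoSupp_subset_iUnion (ht : IsAdmissible t) {g : ℝ ≃ₜ ℝ} (hg : g ∈ limitGroup t) :
    homeoSupp g ⊆ ⋃ n, stageInterval t n := by
  obtain ⟨n, hn⟩ := (mem_limitGroup_iff ht).1 hg
  exact (homeoSupp_subset_of_mem_stageGroup ht hn).trans (subset_iUnion _ n)

/-- The action of `G` on the union of the intervals. -/
noncomputable def limitGroupAction (ht : IsAdmissible t) :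
    limitGroup t →* Equiv.Perm (⋃ n, stageInterval t n : Set ℝ) where
  toFun g :=
    { toFun := fun x => ⟨(g : ℝ ≃ₜ ℝ) x,
        mem_of_homeoSupp_subset (homeoSupp_subset_iUnion ht g.2) x.2⟩
      invFun := fun x => ⟨(g⁻¹ : limitGroup t).1 x,
        mem_of_homeoSupp_subset (homeoSupp_subset_iUnion ht (g⁻¹).2) x.2⟩
      left_inv := fun x => Subtype.ext (homeo_inv_apply_self g.1 x)
      right_inv := fun x => Subtype.ext (homeo_apply_inv_self g.1 x) }
  map_one' := rfl
  map_mul' _ _ := rfl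

lemma limitGroupAction_apply (ht : IsAdmissible t) (g : limitGroup t)
    (x : (⋃ n, stageInterval t n : Set ℝ)) :
    (limitGroupAction ht g x : ℝ) = (g : ℝ ≃ₜ ℝ) x := rfl

lemma limitGroupAction_injective (ht : IsAdmissible t) :
    Function.Injective (limitGroupAction ht) := by
  intro g h e
  refine Subtype.ext (homeo_eq_of_eqOn (homeoSupp_subset_iUnion ht g.2)
    (homeoSupp_subset_iUnion ht h.2) fun x hx => ?_)
  rw [← limitGroupAction_apply ht g ⟨x, hx⟩, e, limitGroupAction_apply]

lemma isBoundedlySupported_limitGroupAction (ht : IsAdmissible t) :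
    IsBoundedlySupported (limitGroupAction ht).range
      (fun n : ℕ => (Subtype.val ⁻¹' stageInterval t n :
        Set (⋃ n, stageInterval t n : Set ℝ))) := by
  refine ⟨Monotone.directed_le fun m n hmn => preimage_mono (stageInterval_monotone ht hmn),
    ?_, ?_⟩
  · rw [← preimage_iUnion, Subtype.coe_preimage_self]
  · rintro _ ⟨g, rfl⟩
    obtain ⟨n, hn⟩ := (mem_limitGroup_iff ht).1 g.2
    exact ⟨n, fun x hx => homeoSupp_subset_of_mem_stageGroup ht hn fun e => hx (Subtype.ext e)⟩

lemma isDissipator_limitGroupAction (ht : IsAdmissible t) (n : ℕ) :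
    IsDissipator (limitGroupAction ht).range
      (Subtype.val ⁻¹' stageInterval t n : Set (⋃ n, stageInterval t n : Set ℝ))
      (limitGroupAction ht ⟨t n, (mem_limitGroup_iff ht).2 ⟨n + 1, mem_stageGroup_succ t n⟩⟩) := by
  set s : limitGroup t := ⟨t n, (mem_limitGroup_iff ht).2 ⟨n + 1, mem_stageGroup_succ t n⟩⟩
    with hs
  have spow : ∀ p : ℕ, (limitGroupAction ht s) ^ p = limitGroupAction ht (s ^ p) :=
    fun p => (map_pow _ _ _).symm
  have scoe : ∀ p : ℕ, ((s ^ p : limitGroup t) : ℝ ≃ₜ ℝ) = t n ^ (p : ℤ) := fun p => by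
    rw [zpow_natCast]; rfl
  have hmem : ∀ (p : ℕ) (x : (⋃ n, stageInterval t n : Set ℝ)),
      x ∈ ((limitGroupAction ht s) ^ p) '' (Subtype.val ⁻¹' stageInterval t n) ↔
        (x : ℝ) ∈ (t n ^ (p : ℤ)) '' stageInterval t n := by
    intro p x
    constructor
    · rintro ⟨y, hy, rfl⟩
      exact ⟨y, hy, by rw [spow, limitGroupAction_apply, scoe]⟩
    · rintro ⟨y, hy, e⟩
      refine ⟨⟨y, mem_iUnion.2 ⟨n, hy⟩⟩, hy, Subtype.ext ?_⟩
      rw [spow, limitGroupAction_apply, scoe, e]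
  refine ⟨⟨s, rfl⟩, fun p hp => ?_, ?_⟩
  · rw [disjoint_left]
    intro x hx hx'
    obtain ⟨y, hy, e⟩ := (hmem p x).1 hx
    refine zpow_apply_notMem_stageInterval ht (by omega : (p : ℤ) ≠ 0) hy ?_
    rw [e]
    exact hx'
  · rintro _ ⟨g, rfl⟩ hg
    have hg' : (g : ℝ ≃ₜ ℝ) ∈ stageGroup t n := by
      refine mem_stageGroup_of_homeoSupp_subset ht g.2 fun x hx => ?_
      exact hg (a := ⟨x, homeoSupp_subset_iUnion ht g.2 hx⟩)
        fun e => hx (congrArg Subtype.val e)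
    -- The family is `g` at positive indices and the identity at indices `p ≤ 0`, which the
    -- dissipator must leave fixed.
    obtain ⟨f, hf, hf1, hf2⟩ := exists_mem_stageGroup_succ_of_family ht (n := n)
      (h := fun p : ℤ => if 1 ≤ p then (g : ℝ ≃ₜ ℝ) else 1) (fun p => by
        split_ifs
        · exact hg'
        · exact one_mem _)
    refine ⟨limitGroupAction ht ⟨f, (mem_limitGroup_iff ht).2 ⟨n + 1, hf⟩⟩, ⟨_, rfl⟩, ?_, ?_⟩
    · intro p hp x hx
      rw [spow, ← map_inv, ← map_mul, ← map_mul]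
      refine Subtype.ext ?_
      rw [limitGroupAction_apply, limitGroupAction_apply]
      have := hf1 p x ((hmem p x).1 hx)
      rw [if_pos (by omega : (1 : ℤ) ≤ p), ← scoe] at this
      exact this
    · intro x hx
      refine Subtype.ext ?_
      rw [limitGroupAction_apply]
      change f x = x
      by_cases hx' : ∃ p : ℤ, (x : ℝ) ∈ (t n ^ p) '' stageInterval t n
      · obtain ⟨p, hp⟩ := hx'
        have hp1 : ¬ 1 ≤ p := by
          intro h
          refine hx p.toNat (by omega) ((hmem _ _).2 ?_)
          rwa [Int.toNat_of_nonneg (by omega)]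
        rw [hf1 p x hp, if_neg hp1, mul_one, mul_inv_cancel, homeo_one_apply]
      · exact hf2 x fun p hp => hx' ⟨p, hp⟩

/-! ### The group has no conjugates in commuting `ℤ`-conjugate -/

/-- The shift of `u` cancels in `u * t n * u⁻¹`, which therefore sends `I_n` into `t n '' I_n`,
where `f` is trivial. Commutation would force `f` to fix every point of `I_n`. -/
lemma not_commute_conj_of_mem_stageGroup (ht : IsAdmissible t) {n : ℕ} {f u : ℝ ≃ₜ ℝ}
    (hf : f ∈ stageGroup t n) (hf1 : f ≠ 1) (hu : u ∈ stageGroup t (n + 1)) :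
    ¬ Commute f (u * t n * u⁻¹) := by
  intro hc
  have hsf := homeoSupp_subset_of_mem_stageGroup ht hf
  obtain ⟨x, hx⟩ : ∃ x, f x ≠ x := by
    by_contra! h
    exact hf1 (Homeomorph.ext h)
  obtain ⟨p, hp⟩ := exists_shift_of_mem_stageGroup_succ ht hu
  -- The indices `-p` and `1 - p` are those that `u` carries to 0 and 1.
  obtain ⟨h, hh, e⟩ := hp (-p)
  obtain ⟨k, hk, e'⟩ := hp (1 + -p)
  simp only [neg_add_cancel, neg_add_cancel_right, zpow_zero, zpow_one, homeo_one_apply] at e e'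
  -- The conjugate of `t n` sends `x` to a point of `t n (I_n)`, which `f` fixes.
  have hy := mem_of_homeoSupp_subset (homeoSupp_subset_of_mem_stageGroup ht (inv_mem hh)) (hsf hx)
  have key : (u * t n * u⁻¹) x = t n (k (h⁻¹ x)) := by
    have e1 := e (h⁻¹ x) hy
    rw [homeo_apply_inv_self] at e1
    have e2 : u⁻¹ x = (t n ^ (-p)) (h⁻¹ x) := by
      rw [← homeo_inv_apply_self u ((t n ^ (-p)) (h⁻¹ x)), e1]
    rw [homeo_mul_apply, homeo_mul_apply, e2, ← e' _ hy, homeo_zpow_add_apply, zpow_one]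
  have hout : (u * t n * u⁻¹) x ∉ stageInterval t n := by
    rw [key]
    exact disjoint_left.1 (ht n).2.2 (mem_image_of_mem _
      (mem_of_homeoSupp_subset (homeoSupp_subset_of_mem_stageGroup ht hk) hy))
  have hfix := apply_eq_of_homeoSupp_subset hsf hout
  rw [← homeo_mul_apply, hc.eq, homeo_mul_apply] at hfix
  exact hx ((u * t n * u⁻¹).injective hfix)

/-- The conjugate by an element of `G` of an element of stage `m` either belongs to stage `m` or
commutes with that stage. -/
lemma conj_mem_or_commute (ht : IsAdmissible t) {m : ℕ} {s r : ℝ ≃ₜ ℝ}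
    (hs : s ∈ stageGroup t m) (hr : r ∈ limitGroup t) :
    r * s * r⁻¹ ∈ stageGroup t m ∨ ∀ f ∈ stageGroup t m, Commute f (r * s * r⁻¹) := by
  have hss := homeoSupp_subset_of_mem_stageGroup ht hs
  -- The conjugate first applies `r⁻¹`. If `r⁻¹` moves `I_m` off itself, the conjugate is trivial on
  -- `I_m`; if `r⁻¹` agrees there with `h`, the conjugate equals `h⁻¹ * s * h`.
  rcases disjoint_or_eqOn_of_mem_limitGroup ht (inv_mem hr) m with h | ⟨h, hh, e⟩
  · right
    intro f hf
    have hsf := homeoSupp_subset_of_mem_stageGroup ht hf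
    have fix : ∀ x ∈ stageInterval t m, (r * s * r⁻¹) x = x := fun x hx => by
      rw [homeo_mul_apply, homeo_mul_apply, apply_eq_of_homeoSupp_subset hss (h x hx),
        homeo_apply_inv_self]
    refine Homeomorph.ext fun x => ?_
    rw [homeo_mul_apply, homeo_mul_apply _ f]
    by_cases hx : x ∈ stageInterval t m
    · rw [fix x hx, fix _ (mem_of_homeoSupp_subset hsf hx)]
    · rw [apply_eq_of_homeoSupp_subset hsf hx]
      refine apply_eq_of_homeoSupp_subset hsf fun hx' => hx ?_
      have := (r * s * r⁻¹).injective (fix _ hx')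
      rwa [this] at hx'
  · left
    have hsh := homeoSupp_subset_of_mem_stageGroup ht hh
    have hsh' := homeoSupp_subset_of_mem_stageGroup ht (inv_mem hh)
    have hr' : ∀ y ∈ stageInterval t m, r y = h⁻¹ y := fun y hy => by
      have := e (h⁻¹ y) (mem_of_homeoSupp_subset hsh' hy)
      rw [homeo_apply_inv_self] at this
      calc r y = r (r⁻¹ (h⁻¹ y)) := by rw [this]
        _ = h⁻¹ y := homeo_apply_inv_self _ _
    have hconj : h⁻¹ * s * h⁻¹⁻¹ ∈ stageGroup t m :=
      mul_mem (mul_mem (inv_mem hh) hs) (inv_mem (inv_mem hh))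
    have : r * s * r⁻¹ = h⁻¹ * s * h⁻¹⁻¹ := by
      refine homeo_eq_of_eqOn (A := stageInterval t m) (fun x hx => ?_)
        (homeoSupp_subset_of_mem_stageGroup ht hconj) fun x hx => ?_
      · have hx' : r⁻¹ x ∈ stageInterval t m := by
          by_contra hne
          apply hx
          rw [homeo_mul_apply, homeo_mul_apply, apply_eq_of_homeoSupp_subset hss hne,
            homeo_apply_inv_self]
        have := hr' _ hx'
        rw [homeo_apply_inv_self] at this
        rw [this]
        exact mem_of_homeoSupp_subset hsh' hx'
      · rw [inv_inv, homeo_mul_apply, homeo_mul_apply, homeo_mul_apply, homeo_mul_apply, e x hx]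
        exact hr' _ (mem_of_homeoSupp_subset hss (mem_of_homeoSupp_subset hsh hx))
    rwa [this]

lemma not_hasConjugatesInCommutingZConjugate (ht : IsAdmissible t) :
    ¬ HasConjugatesInCommutingZConjugate (limitGroup t) := by
  rintro ⟨Λ, s, hcomm, hconj⟩
  obtain ⟨n, hn⟩ := (mem_limitGroup_iff ht).1 s.2
  have hmem : ∀ k, t k ∈ limitGroup t := fun k =>
    (mem_limitGroup_iff ht).2 ⟨k + 1, mem_stageGroup_succ t k⟩
  set a : limitGroup t := ⟨t n, hmem n⟩
  set b : limitGroup t := ⟨t (n + 1), hmem (n + 1)⟩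
  -- A two-element set and the exponent `p = 1` suffice for the contradiction.
  obtain ⟨r, hr⟩ := hconj {a, b} (toFinite _)
  obtain ⟨a', ha', ea⟩ := hr (mem_insert a {b})
  obtain ⟨b', hb', eb⟩ := hr (mem_insert_of_mem a (mem_singleton b))
  have ea' : r * a' * r⁻¹ = a := ea
  have eb' : r * b' * r⁻¹ = b := eb
  have hc : Commute a' (s * b' * s⁻¹) := by
    rw [← commutatorElement_eq_one_iff_commute, ← Subgroup.mem_bot, ← hcomm 1 le_rfl, pow_one]
    exact Subgroup.commutator_mem_commutator ha' ⟨b', hb', rfl⟩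
  have hc' : Commute a (r * s * r⁻¹ * b * (r * s * r⁻¹)⁻¹) := by
    have := hc.map (MulAut.conj r)
    simp only [MulAut.conj_apply] at this
    rw [ea'] at this
    have e : r * s * r⁻¹ * b * (r * s * r⁻¹)⁻¹ = r * (s * b' * s⁻¹) * r⁻¹ := by
      rw [← eb']
      group
    rwa [e]
  have hc'' : Commute (t n) ((r : ℝ ≃ₜ ℝ) * s * (r : ℝ ≃ₜ ℝ)⁻¹ * t (n + 1) *
      ((r : ℝ ≃ₜ ℝ) * s * (r : ℝ ≃ₜ ℝ)⁻¹)⁻¹) := hc'.map (limitGroup t).subtype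
  have hne : t n ≠ 1 := fun h => by
    obtain ⟨x, hx⟩ := (ht n).2.1.nonempty
    exact hx (by rw [h]; rfl)
  rcases conj_mem_or_commute ht (stageGroup_monotone ht (by omega : n ≤ n + 1 + 1) hn) r.2
    with hu | hu
  · exact not_commute_conj_of_mem_stageGroup ht (mem_stageGroup_succ t n) hne hu hc''
  -- Here `r * s * r⁻¹` commutes with `t (n + 1)`, so the conjugate is `t (n + 1)` itself and `u =
  -- 1` serves.
  · rw [← (hu _ (mem_stageGroup_succ t (n + 1))).eq, mul_inv_cancel_right] at hc''
    refine not_commute_conj_of_mem_stageGroup ht (mem_stageGroup_succ t n) hne (one_mem _) ?_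
    rwa [one_mul, inv_one, mul_one]

end Stages

/-! ### Existence of admissible choices -/

/-- For `M > 0` the lines `2x + 3M` and `(x + 3M)/2` meet the diagonal at `-3M` and `3M` and each
other at `(-M, M)`. So `-M` goes to `M`, and `(-M, M)` goes above `M`. -/
lemma exists_homeo_homeoSupp_eq_Ioo (M : ℝ) :
    ∃ s : ℝ ≃ₜ ℝ, homeoSupp s = Ioo (-(3 * M)) (3 * M) ∧
      Disjoint (s '' Ioo (-M) M) (Ioo (-M) M) := by
  set f : ℝ → ℝ := fun x => max x (min (2 * x + 3 * M) ((x + 3 * M) / 2)) with hf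
  have hmono : StrictMono f := by
    intro x y h
    exact max_lt_max h (min_lt_min (by linarith) (by linarith))
  have hcont : Continuous f := by fun_prop
  have hout : ∀ x, x ∉ Ioo (-(3 * M)) (3 * M) → f x = x := by
    intro x hx
    refine max_eq_left ?_
    by_cases h : -(3 * M) < x
    · have : 3 * M ≤ x := by
        by_contra! h'
        exact hx ⟨h, h'⟩
      exact (min_le_right _ _).trans (by linarith)
    · exact (min_le_left _ _).trans (by linarith)
  have hsurj : Function.Surjective f := by
    refine hcont.surjective
      (Filter.tendsto_atTop_mono (fun x => le_max_left _ _) Filter.tendsto_id) ?_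
    refine Filter.Tendsto.congr' ?_ Filter.tendsto_id
    filter_upwards [Filter.eventually_le_atBot (-(3 * M))] with x hx
    exact (hout x fun h => absurd h.1 (not_lt.2 hx)).symm
  refine ⟨(hmono.orderIsoOfSurjective f hsurj).toHomeomorph, ?_, ?_⟩
  · ext x
    change f x ≠ x ↔ _
    constructor
    · intro h
      by_contra hx
      exact h (hout x hx)
    · rintro ⟨h1, h2⟩
      refine ne_of_gt (lt_max_of_lt_right (lt_min ?_ ?_)) <;> linarith
  · rw [disjoint_left]
    rintro _ ⟨x, hx, rfl⟩ h
    have h' : f x < M := h.2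
    have : M < f x := lt_max_of_lt_right (lt_min (by linarith [hx.1]) (by linarith [hx.1]))
    linarith

lemma exists_isAdmissible : ∃ t : ℕ → ℝ ≃ₜ ℝ, IsAdmissible t := by
  -- With `M = 3 ^ n` the support is `(-3 ^ (n + 1), 3 ^ (n + 1))`, exactly the interval that the
  -- next choice displaces.
  choose t hsupp hdisj using fun n : ℕ =>
    exists_homeo_homeoSupp_eq_Ioo ((3 : ℝ) ^ n)
  have hsub : ∀ n, stageInterval t n ⊆ Ioo (-(3 : ℝ) ^ n) (3 ^ n) := by
    rintro (_ | n)
    · exact Ioo_subset_Ioo (by norm_num) (by norm_num)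
    · change homeoSupp (t n) ⊆ _
      rw [hsupp, pow_succ']
  refine ⟨t, fun n => ⟨?_, ?_, (hdisj n).mono (image_mono (hsub n)) (hsub n)⟩⟩
  · rw [hsupp]
    exact Metric.isBounded_Ioo _ _
  · rw [hsupp]
    have := pow_pos (by norm_num : (0 : ℝ) < 3) n
    exact isConnected_Ioo (by linarith)

/-- Admissible choices exist and, for every admissible choice, the group `G = limitGroup t`, acting
on the union of the intervals, is dissipated with respect to these intervals, and `G` does not have
conjugates in commuting `ℤ`-conjugate. -/
theorem mainTheorem4 :
    (∃ t : ℕ → ℝ ≃ₜ ℝ, IsAdmissible t) ∧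
    ∀ t : ℕ → ℝ ≃ₜ ℝ, IsAdmissible t →
      (∃ ρ : limitGroup t →* Equiv.Perm (⋃ n, stageInterval t n : Set ℝ),
        Function.Injective ρ ∧
        (∀ (g : limitGroup t) (x : (⋃ n, stageInterval t n : Set ℝ)),
          (ρ g x : ℝ) = (g : ℝ ≃ₜ ℝ) (x : ℝ)) ∧
        IsDissipated ρ.range
          (fun n : ℕ => (Subtype.val ⁻¹' stageInterval t n : Set (⋃ n, stageInterval t n : Set ℝ)))) ∧
      ¬ HasConjugatesInCommutingZConjugate (limitGroup t) := by
  exact ⟨exists_isAdmissible, fun t ht =>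
    ⟨⟨limitGroupAction ht, limitGroupAction_injective ht, limitGroupAction_apply ht,
      isBoundedlySupported_limitGroupAction ht, fun n => ⟨_, isDissipator_limitGroupAction ht n⟩⟩,
      not_hasConjugatesInCommutingZConjugate ht⟩⟩
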